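/- Let $F,G,H$ be Borel probability measures on $\mathbb{R}^d$ with finite first moments and let $a>0$. Let $X_1,X_2,\dots$ be i.i.d. from $F$ and $Y_1,Y_2,\dots$ i.i.d. from $G$. For $n,N\ge 1$ put $$H^*=\frac{a}{a+n}H+\frac{n}{a+n}\cdot\frac1n\sum_{i=1}^n\delta_{X_i},\qquad F^{\mathrm{pos}}_N=\sum_{i=1}^N J^{\mathrm{pos}}_{i,N}\,\delta_{X^{\mathrm{pos}}_i},\qquad G_{Y_{1:N}}=\frac1N\sum_{i=1}^N\delta_{Y_i},$$ where, conditionally on $X_1,\dots,X_n$, the locations $X^{\mathrm{pos}}_1,\dots,X^{\mathrm{pos}}_N$ are i.i.d. from $H^*$, and the weights $(J^{\mathrm{pos}}_{1,N},\dots,J^{\mathrm{pos}}_{N,N})\sim\mathrm{Dir}\left(\frac{a+n}{N},\dots,\frac{a+n}{N}\right)$ are independent of the locations. (This is the finite approximation of the posterior $DP(a+n,H^*)$ of a Dirichlet process prior $DP(a,H)$ given $X_1,\dots,X_n$.) For a nonempty family $\mathcal D=\{Dis_\theta\}_{\theta\in\Theta}$ of $1$-Lipschitz functions $\mathbb{R}^d\to\mathbb{R}$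 let $$W_{\mathcal D}(\mu,\nu)=\sup_{\theta\in\Theta}\left(E_\mu[Dis_\theta]-E_\nu[Dis_\theta]\right),\quad\text{so that}\quad W_{\mathcal D}(F^{\mathrm{pos}}_N,G_{Y_{1:N}})=\sup_{\theta\in\Theta}\sum_{i=1}^N\left(J^{\mathrm{pos}}_{i,N}\,Dis_\theta(X^{\mathrm{pos}}_i)-\frac{Dis_\theta(Y_i)}{N}\right)$$ (the supremum is a maximum when $\Theta$ is compact and $Dis_\theta(x)$ is continuous in $\theta$ for every $x$). If $\mathcal D$ is the class of all $1$-Lipschitz functions, $W_{\mathcal D}=W$ is the Wasserstein distance. Then: 1. $W(F^{\mathrm{pos}}_N,G_{Y_{1:N}})\to0$ in probability as $N,n\to\infty$ if and only if $G=F$. 2. For every nonempty family $\mathcal D$ of $1$-Lipschitz functions, $W_{\mathcal D}(F^{\mathrm{pos}}_N,G_{Y_{1:N}})\to 0$ in probability as $N,n\to\infty$ if and only if $W_{\mathcal D}(F,G)=0$; in particular this holds whenever $G=F$. If moreover $W_{\mathcal D}$ satisfies the equality condition of a distance, that is, $W_{\mathcal D}(\mu,\nu)=0$ implies $\mu=\nu$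 for all Borel probability measures $\mu,\nu$ on $\mathbb{R}^d$ with finite first moments, then $W_{\mathcal D}(F^{\mathrm{pos}}_N,G_{Y_{1:N}})\to0$ in probability as $N,n\to\infty$ if and only if $G=F$. -/

import Mathlib

open MeasureTheory ProbabilityTheory Filter
open scoped ENNReal

noncomputable section

namespace BNPWasserstein

/-- The Dirichlet distribution `Dir(α)`: the law of `(Γ i / ∑ j, Γ j)_i` for independent
`Γ i ∼ Gamma(α i, 1)`. -/
def dirichletMeasure {ι : Type*} [Fintype ι] (α : ι → ℝ) : Measure (ι → ℝ) :=
  (Measure.pi fun i => gammaMeasure (α i) 1).map (fun g i => g i / ∑ j, g j)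

section Measurable

variable {E : Type*} [MeasurableSpace E]

/-- The empirical distribution `n⁻¹ ∑ δ_{x i}` of a sample of size `n`. -/
def empirical {n : ℕ} (x : Fin n → E) : Measure E :=
  (n : ℝ≥0∞)⁻¹ • ∑ i, Measure.dirac (x i)

/-- The posterior base measure `H* = a/(a+n) H + n/(a+n) F_{x_{1:n}}`. -/
def posteriorBase {n : ℕ} (a : ℝ) (H : Measure E) (x : Fin n → E) : Measure E :=
  ENNReal.ofReal (a / (a + n)) • H + ENNReal.ofReal (n / (a + n)) • empirical x

instance {n : ℕ} (x : Fin n → E) : IsFiniteMeasure (empirical x) := by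
  rcases Nat.eq_zero_or_pos n with rfl | hn
  · simp only [empirical, Finset.univ_eq_empty, Finset.sum_empty, smul_zero]
    infer_instance
  · exact Measure.smul_finite _ (ENNReal.inv_ne_top.2 (by exact_mod_cast hn.ne'))

instance {n : ℕ} (a : ℝ) (H : Measure E) [IsFiniteMeasure H] (x : Fin n → E) :
    IsFiniteMeasure (posteriorBase a H x) := by
  have h1 := Measure.smul_finite H (ENNReal.ofReal_ne_top (r := a / (a + n)))
  have h2 := Measure.smul_finite (empirical x) (ENNReal.ofReal_ne_top (r := n / (a + n)))
  unfold posteriorBase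
  infer_instance

lemma measurable_posteriorBase_apply {n : ℕ} (a : ℝ) (H : Measure E) {s : Set E}
    (hs : MeasurableSet s) : Measurable fun x : Fin n → E => posteriorBase a H x s := by
  have h : ∀ i : Fin n, Measurable fun x : Fin n → E => Measure.dirac (x i) s := fun i =>
    (Measure.measurable_coe hs).comp (Measure.measurable_dirac.comp (measurable_pi_apply i))
  simp only [posteriorBase, empirical, Measure.add_apply, Measure.smul_apply, smul_eq_mul,
    Measure.finsetSum_apply]
  exact measurable_const.add (((Finset.measurable_sum _ fun i _ => h i).const_mul _).const_mul _)

lemma measurable_pi_posteriorBase {n : ℕ} (N : ℕ) (a : ℝ) (H : Measure E) [IsFiniteMeasure H] :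
    Measurable fun x : Fin n → E => Measure.pi fun _ : Fin N => posteriorBase a H x := by
  refine Measurable.measure_of_isPiSystem generateFrom_pi.symm isPiSystem_pi ?_ ?_
  · rintro _ ⟨t, ht, rfl⟩
    simp only [Measure.pi_pi]
    exact Finset.measurable_prod _ fun i _ =>
      measurable_posteriorBase_apply a H (ht i (Set.mem_univ i))
  · simp only [Measure.pi_univ]
    exact Finset.measurable_prod _ fun i _ => measurable_posteriorBase_apply a H .univ

/-- Given the data `x = (x_1, …, x_n)`, the law of an i.i.d. sample of size `N` from the posterior
base measure `H*`. -/
def posteriorLocations (n N : ℕ) (a : ℝ) (H : Measure E) [IsFiniteMeasure H] :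
    Kernel (Fin n → E) (Fin N → E) where
  toFun x := Measure.pi fun _ => posteriorBase a H x
  measurable' := measurable_pi_posteriorBase N a H

/-- The sampling scheme. `X i` are the data (i.i.d. from `F`), `Y i` the generated sample (i.i.d.
from `G`); for every data size `n ≥ 1` and every number of atoms `N ≥ 1`, conditionally on
`X_{1:n}` the locations `Xpos n N` are i.i.d. from `H*`, and the weights `J n N` have the law
`Dir((a+n)/N, …, (a+n)/N)` and are independent of the locations. -/
structure IsPosteriorSampling {Ω : Type*} [MeasurableSpace Ω] (P : Measure Ω) (a : ℝ)
    (H F G : Measure E) [IsFiniteMeasure H] (X Y : ℕ → Ω → E)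
    (Xpos : (n N : ℕ) → Ω → Fin N → E) (J : (n N : ℕ) → Ω → Fin N → ℝ) : Prop where
  law_X : ∀ i, HasLaw (X i) F P
  indep_X : iIndepFun X P
  law_Y : ∀ i, HasLaw (Y i) G P
  indep_Y : iIndepFun Y P
  law_Xpos : ∀ n N, 0 < n → 0 < N →
    HasCondDistrib (Xpos n N) (fun ω (i : Fin n) => X i ω) (posteriorLocations n N a H) P
  law_J : ∀ n N, 0 < n → 0 < N →
    HasLaw (J n N) (dirichletMeasure fun _ : Fin N => (a + n) / N) P
  indep_J : ∀ n N, 0 < n → 0 < N → IndepFun (J n N) (Xpos n N) P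

/-- The distance `W(μ, ν) = sup_θ (E_μ[D_θ] - E_ν[D_θ])` given by a family of discriminators. -/
def discDist {Θ : Type*} (D : Θ → E → ℝ) (μ ν : Measure E) : ℝ :=
  ⨆ θ, (∫ x, D θ x ∂μ - ∫ x, D θ x ∂ν)

/-- The same distance between the weighted sample `∑ J i δ_{x i}` and the empirical distribution of
`y`, written out: `sup_θ ∑ i, (J i D_θ(x i) - D_θ(y i) / N)`. -/
def discDistSample {Θ : Type*} (D : Θ → E → ℝ) {N : ℕ} (J : Fin N → ℝ) (x y : Fin N → E) : ℝ :=
  ⨆ θ, ∑ i, (J i * D θ (x i) - D θ (y i) / N)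

/-- `discDistSample` is `discDist` between the corresponding discrete measures. -/
lemma discDistSample_eq {Θ : Type*} [MeasurableSingletonClass E] (D : Θ → E → ℝ) {N : ℕ}
    (J : Fin N → ℝ) (hJ : ∀ i, 0 ≤ J i) (x y : Fin N → E) :
    discDistSample D J x y =
      discDist D (∑ i, ENNReal.ofReal (J i) • Measure.dirac (x i)) (empirical y) := by
  unfold discDistSample discDist empirical
  congr 1
  funext θ
  rw [integral_smul_measure, integral_finsetSum_measure, integral_finsetSum_measure]
  · simp only [integral_smul_measure, integral_dirac, smul_eq_mul, ENNReal.toReal_inv,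
      ENNReal.toReal_natCast, ENNReal.toReal_ofReal (hJ _), Finset.sum_sub_distrib,
      Finset.mul_sum]
    congr 1
    exact Finset.sum_congr rfl fun i _ => by ring
  · exact fun i _ => integrable_dirac (by simp)
  · exact fun i _ => (integrable_dirac (by simp)).smul_measure ENNReal.ofReal_ne_top

end Measurable

/-- The family of all real-valued 1-Lipschitz functions; its `discDist` is the Wasserstein distance
in Kantorovich–Rubinstein form. -/
def allLipschitz (E : Type*) [PseudoEMetricSpace E] : {D : E → ℝ // LipschitzWith 1 D} → E → ℝ :=
  Subtype.val

/-- The equality condition of a distance: `W(μ, ν) = 0` only for `μ = ν`, among probability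
measures with finite first moment. -/
def EqualityCondition {Θ E : Type*} [NormedAddCommGroup E] [MeasurableSpace E]
    (D : Θ → E → ℝ) : Prop :=
  ∀ μ ν : Measure E, IsProbabilityMeasure μ → IsProbabilityMeasure ν →
    Integrable (fun x => ‖x‖) μ → Integrable (fun x => ‖x‖) ν → discDist D μ ν = 0 → μ = ν

/-- `W(F^pos_N, G_{Y_{1:N}}) → 0` in probability as `n, N → ∞` jointly. -/
def TendsToZeroInProb {Ω Θ E : Type*} [MeasurableSpace Ω] [MeasurableSpace E] (P : Measure Ω)
    (D : Θ → E → ℝ) (Y : ℕ → Ω → E) (Xpos : (n N : ℕ) → Ω → Fin N → E)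
    (J : (n N : ℕ) → Ω → Fin N → ℝ) : Prop :=
  TendstoInMeasure P
    (fun (p : ℕ × ℕ) ω => discDistSample D (J p.1 p.2 ω) (Xpos p.1 p.2 ω) (fun i => Y i ω))
    (atTop ×ˢ atTop) (fun _ => 0)

end BNPWasserstein

end

/-! The whole theorem follows from one limit: for any nonempty family of 1-Lipschitz functions, the
sample distance converges in probability to `discDist D F G`. Limits in probability are unique, so
it tends to 0 exactly when `discDist D F G = 0`. For the class of all 1-Lipschitz functions, or
under the equality condition, this means `F = G`.

The limit needs a law of large numbers uniform over 1-Lipschitz functions. A simple function `T`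
close to the identity in mean reduces it to finitely many cells: the integrals of `f` against two
probability measures differ by at most the two mean displacements plus the discrepancies of the cell
masses, each weighted by the norm of the cell's value (`abs_integral_sub_le_discretizationError`).
This bound does not involve `f`.

The cell discrepancies are weighted sums `∑ J i * z (x i)` with `|z| ≤ 1` and `z` centred under the
target law. Since the weights are independent of the locations, the second moment is at most `E ∑ J
i ^ 2 + q`, where `q` bounds the mixed moments of `z` at two distinct locations
(`integral_sq_sum_le`). For the Dirichlet weights, `E ∑ J i ^ 2 ≤ 4 / N + 8 / (a + n)` by the gamma
representation. For the posterior locations, conditioning on the data turns the mixed moment into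
the second moment of `∫ z dH*`, which is of order `(a / (a + n)) ^ 2 + 1 / n`. The prior base
measure `H` thus disappears in the limit. The sample from `G` is the case of constant weights and `q
= 0`. Markov's inequality concludes. -/

noncomputable section

namespace BNPWasserstein

/-! ### Discretization bound for integrals of 1-Lipschitz functions -/

section Deterministic

variable {E : Type*} [NormedAddCommGroup E] [MeasurableSpace E] [BorelSpace E]
  [SecondCountableTopology E]

/-- A bound, uniform over 1-Lipschitz functions, for the difference of the integrals against two
measures, in terms of a discretization `T` of the space. -/
def discretizationError (T : SimpleFunc E E) (μ ν : Measure E) : ℝ :=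
  ∫ x, ‖x - T x‖ ∂μ + ∫ x, ‖x - T x‖ ∂ν +
    ∑ c ∈ T.range, ‖c‖ * |μ.real (T ⁻¹' {c}) - ν.real (T ⁻¹' {c})|

omit [SecondCountableTopology E] in
lemma integrable_of_lipschitzWith {μ : Measure E} [IsFiniteMeasure μ]
    (hμ : Integrable (fun x => ‖x‖) μ) {f : E → ℝ} (hf : LipschitzWith 1 f) : Integrable f μ := by
  refine (hμ.add (integrable_const |f 0|)).mono' hf.continuous.aestronglyMeasurable ?_
  refine ae_of_all _ fun x => ?_
  have h := hf.dist_le_mul x 0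
  rw [Real.dist_eq, dist_zero_right] at h
  have h' := abs_sub_abs_le_abs_sub (f x) (f 0)
  simp only [NNReal.coe_one, one_mul] at h
  simp only [Pi.add_apply, Real.norm_eq_abs]
  linarith

lemma integrable_norm_sub_simpleFunc {μ : Measure E} [IsFiniteMeasure μ]
    (hμ : Integrable (fun x => ‖x‖) μ) (T : SimpleFunc E E) :
    Integrable (fun x => ‖x - T x‖) μ := by
  have hid : Integrable (fun x : E => x) μ :=
    (integrable_norm_iff measurable_id.aestronglyMeasurable).1 hμ
  exact (hid.sub (T.integrable_of_isFiniteMeasure)).norm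

omit [NormedAddCommGroup E] [BorelSpace E] [SecondCountableTopology E] in
lemma integral_comp_simpleFunc {μ : Measure E} [IsFiniteMeasure μ] (T : SimpleFunc E E)
    (h : E → ℝ) : ∫ x, h (T x) ∂μ = ∑ c ∈ T.range, μ.real (T ⁻¹' {c}) * h c := by
  have hpt : ∀ x, h (T x) = ∑ c ∈ T.range, (T ⁻¹' {c}).indicator (fun _ => h c) x := fun x => by
    rw [Finset.sum_eq_single_of_mem (T x) (T.mem_range_self x)]
    · simp
    · intro c _ hc
      exact Set.indicator_of_notMem (fun hx => hc (by simpa using Eq.symm hx)) _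
  simp only [hpt]
  rw [integral_finsetSum _ fun c _ =>
    (integrable_const (h c)).indicator (T.measurableSet_fiber c)]
  simp [integral_indicator_const, T.measurableSet_fiber]

/-- Replacing `f` by `f ∘ T` costs at most the mean displacement under each measure. What remains is
a finite sum over the values `c` of `T`. Both masses being 1, `f` may be normalized by `f 0`, and
then `|f c - f 0| ≤ ‖c‖` removes `f` from the bound. -/
lemma abs_integral_sub_le_discretizationError {μ ν : Measure E} [IsProbabilityMeasure μ]
    [IsProbabilityMeasure ν] (hμ : Integrable (fun x => ‖x‖) μ)
    (hν : Integrable (fun x => ‖x‖) ν) (T : SimpleFunc E E) {f : E → ℝ}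
    (hf : LipschitzWith 1 f) :
    |∫ x, f x ∂μ - ∫ x, f x ∂ν| ≤ discretizationError T μ ν := by
  have key : ∀ ρ : Measure E, IsProbabilityMeasure ρ → Integrable (fun x => ‖x‖) ρ →
      |∫ x, f x ∂ρ - f 0 - ∑ c ∈ T.range, ρ.real (T ⁻¹' {c}) * (f c - f 0)| ≤
        ∫ x, ‖x - T x‖ ∂ρ := by
    intro ρ _ hρ
    have hint := integrable_of_lipschitzWith hρ hf
    have hint2 : Integrable (fun x => f (T x) - f 0) ρ :=
      (SimpleFunc.integrable_of_isFiniteMeasure (T.map f)).sub (integrable_const _)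
    rw [← integral_comp_simpleFunc T (fun c => f c - f 0)]
    have h1 : ∫ x, f x ∂ρ - f 0 - ∫ x, (f (T x) - f 0) ∂ρ
        = ∫ x, ((f x - f 0) - (f (T x) - f 0)) ∂ρ := by
      rw [integral_sub (f := fun x => f x - f 0) (hint.sub (integrable_const _)) hint2,
        integral_sub hint (integrable_const _)]
      simp
    rw [h1]
    refine (abs_integral_le_integral_abs).trans ?_
    refine integral_mono_of_nonneg (ae_of_all _ fun _ => abs_nonneg _)
      (integrable_norm_sub_simpleFunc hρ T) (ae_of_all _ fun x => ?_)
    have h := hf.dist_le_mul x (T x)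
    simp only [NNReal.coe_one, one_mul, dist_eq_norm] at h
    simpa using h
  have hsum : |∑ c ∈ T.range, μ.real (T ⁻¹' {c}) * (f c - f 0) -
      ∑ c ∈ T.range, ν.real (T ⁻¹' {c}) * (f c - f 0)| ≤
      ∑ c ∈ T.range, ‖c‖ * |μ.real (T ⁻¹' {c}) - ν.real (T ⁻¹' {c})| := by
    rw [← Finset.sum_sub_distrib]
    refine (Finset.abs_sum_le_sum_abs _ _).trans (Finset.sum_le_sum fun c _ => ?_)
    rw [← sub_mul, abs_mul, mul_comm]
    refine mul_le_mul_of_nonneg_right ?_ (abs_nonneg _)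
    have h := hf.dist_le_mul c 0
    simpa [Real.dist_eq] using h
  have h1 := abs_le.1 (key μ inferInstance hμ)
  have h2 := abs_le.1 (key ν inferInstance hν)
  have h3 := abs_le.1 hsum
  unfold discretizationError
  exact abs_le.2 ⟨by linarith [h1.1, h2.2, h3.1], by linarith [h1.2, h2.1, h3.2]⟩

lemma exists_simpleFunc_integral_norm_sub_lt {μ : Measure E} [IsFiniteMeasure μ]
    (hμ : Integrable (fun x => ‖x‖) μ) {ε : ℝ} (hε : 0 < ε) :
    ∃ T : SimpleFunc E E, ∫ x, ‖x - T x‖ ∂μ < ε := by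
  have hid : Integrable (fun x : E => x) μ :=
    (integrable_norm_iff measurable_id.aestronglyMeasurable).1 hμ
  obtain ⟨T, hT, -⟩ := (memLp_one_iff_integrable.2 hid).exists_simpleFunc_eLpNorm_sub_lt
    ENNReal.one_ne_top (ENNReal.ofReal_pos.2 hε).ne'
  refine ⟨T, ?_⟩
  rw [eLpNorm_one_eq_lintegral_enorm] at hT
  rw [integral_norm_eq_lintegral_enorm (f := fun x => x - T x)
    (measurable_id.aestronglyMeasurable.sub T.aestronglyMeasurable)]
  refine ENNReal.toReal_lt_of_lt_ofReal hT

end Deterministic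

/-! ### Moments of the gamma law -/

section Gamma

lemma measurable_gammaPDF (α r : ℝ) : Measurable (gammaPDF α r) :=
  (measurable_gammaPDFReal α r).ennreal_ofReal

/-- Size-biasing raises the shape parameter by one, by `Γ(α + 1) = α Γ(α)`. Applied once and twice,
it gives the first two moments without further integration. -/
lemma gammaPDF_mul_ofReal {α : ℝ} (hα : 0 < α) (x : ℝ) :
    gammaPDF α 1 x * ENNReal.ofReal x = ENNReal.ofReal α * gammaPDF (α + 1) 1 x := by
  rcases lt_or_ge x 0 with hx | hx
  · simp [gammaPDF_of_neg hx]
  · have hΓ := Real.Gamma_pos_of_pos hα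
    rw [gammaPDF_of_nonneg hx, gammaPDF_of_nonneg hx, ← ENNReal.ofReal_mul (by positivity),
      ← ENNReal.ofReal_mul hα.le, Real.Gamma_add_one hα.ne']
    congr 1
    rcases hx.eq_or_lt with rfl | hx
    · simp [Real.zero_rpow hα.ne']
    · have h : x ^ (α + 1 - 1) = x ^ (α - 1) * x := by
        rw [← Real.rpow_add_one hx.ne']
        ring_nf
      rw [h]
      simp only [Real.one_rpow]
      field_simp

lemma ae_pos_gammaMeasure {α : ℝ} : ∀ᵐ x ∂gammaMeasure α 1, 0 < x := by
  rw [gammaMeasure, ae_withDensity_iff (measurable_gammaPDF α 1)]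
  have h0 : ∀ᵐ x : ℝ, x ≠ 0 := by simp [ae_iff]
  filter_upwards [h0] with x hx hne
  by_contra h
  exact hne (gammaPDF_of_neg (lt_of_le_of_ne (not_lt.1 h) hx))

lemma lintegral_ofReal_gammaMeasure {α : ℝ} (hα : 0 < α) :
    ∫⁻ x, ENNReal.ofReal x ∂gammaMeasure α 1 = ENNReal.ofReal α := by
  rw [gammaMeasure, lintegral_withDensity_eq_lintegral_mul _
    (measurable_gammaPDF α 1) ENNReal.measurable_ofReal]
  simp only [Pi.mul_apply, gammaPDF_mul_ofReal hα]
  rw [lintegral_const_mul _ (measurable_gammaPDF _ 1),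
    lintegral_gammaPDF_eq_one (by linarith) one_pos, mul_one]

lemma lintegral_ofReal_sq_gammaMeasure {α : ℝ} (hα : 0 < α) :
    ∫⁻ x, ENNReal.ofReal x * ENNReal.ofReal x ∂gammaMeasure α 1 =
      ENNReal.ofReal (α * (α + 1)) := by
  rw [gammaMeasure, lintegral_withDensity_eq_lintegral_mul _
    (measurable_gammaPDF α 1)
    (g := fun x => ENNReal.ofReal x * ENNReal.ofReal x)
    (ENNReal.measurable_ofReal.mul ENNReal.measurable_ofReal)]
  simp only [Pi.mul_apply, ← mul_assoc, gammaPDF_mul_ofReal hα]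
  simp only [mul_assoc, gammaPDF_mul_ofReal (by linarith : 0 < α + 1)]
  rw [lintegral_const_mul _ ((measurable_gammaPDF _ 1).const_mul _),
    lintegral_const_mul _ (measurable_gammaPDF _ 1),
    lintegral_gammaPDF_eq_one (by linarith) one_pos, mul_one, ENNReal.ofReal_mul hα.le]

lemma integral_id_gammaMeasure {α : ℝ} (hα : 0 < α) : ∫ x, x ∂gammaMeasure α 1 = α := by
  rw [integral_eq_lintegral_of_nonneg_ae (ae_pos_gammaMeasure.mono fun _ h => h.le)
    measurable_id.aestronglyMeasurable, lintegral_ofReal_gammaMeasure hα,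
    ENNReal.toReal_ofReal hα.le]

lemma lintegral_ofReal_pow_gammaMeasure {α : ℝ} (hα : 0 < α) :
    ∫⁻ x, ENNReal.ofReal (x ^ 2) ∂gammaMeasure α 1 = ENNReal.ofReal (α * (α + 1)) := by
  rw [← lintegral_ofReal_sq_gammaMeasure hα]
  refine lintegral_congr_ae (ae_pos_gammaMeasure.mono fun x hx => ?_)
  simp only [sq, ENNReal.ofReal_mul hx.le]

lemma integral_sq_gammaMeasure {α : ℝ} (hα : 0 < α) :
    ∫ x, x ^ 2 ∂gammaMeasure α 1 = α * (α + 1) := by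
  rw [integral_eq_lintegral_of_nonneg_ae (ae_of_all _ fun x => sq_nonneg x)
    (measurable_id.pow_const 2).aestronglyMeasurable, lintegral_ofReal_pow_gammaMeasure hα,
    ENNReal.toReal_ofReal (by positivity)]

lemma memLp_id_gammaMeasure {α : ℝ} (hα : 0 < α) :
    MemLp (fun x : ℝ => x) 2 (gammaMeasure α 1) := by
  rw [memLp_two_iff_integrable_sq (f := fun x => x) measurable_id.aestronglyMeasurable]
  refine ⟨(measurable_id.pow_const 2).aestronglyMeasurable, ?_⟩
  rw [hasFiniteIntegral_iff_ofReal (ae_of_all _ fun x => sq_nonneg x),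
    lintegral_ofReal_pow_gammaMeasure hα]
  exact ENNReal.ofReal_lt_top

lemma variance_id_gammaMeasure {α : ℝ} (hα : 0 < α) :
    Var[fun x => x; gammaMeasure α 1] = α := by
  have := isProbabilityMeasure_gammaMeasure hα one_pos
  rw [variance_eq_sub (memLp_id_gammaMeasure hα)]
  simp only [Pi.pow_apply]
  rw [integral_sq_gammaMeasure hα, integral_id_gammaMeasure hα]
  ring

end Gamma

/-! ### Second moment of symmetric Dirichlet weights -/

section Dirichlet

variable {N : ℕ} {α : ℝ}

lemma measurable_normalize {ι : Type*} [Fintype ι] :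
    Measurable fun (g : ι → ℝ) i => g i / ∑ j, g j := by fun_prop

lemma ae_pi_gammaMeasure_pos (hα : 0 < α) :
    ∀ᵐ g ∂Measure.pi fun _ : Fin N => gammaMeasure α 1, ∀ i, 0 < g i := by
  have := isProbabilityMeasure_gammaMeasure hα one_pos
  rw [ae_all_iff]
  exact fun i => (measurePreserving_eval (fun _ : Fin N => gammaMeasure α 1) i
    ).quasiMeasurePreserving.ae ae_pos_gammaMeasure

lemma ae_dirichletMeasure_mem_stdSimplex (hN : 0 < N) (hα : 0 < α) :
    ∀ᵐ j ∂dirichletMeasure fun _ : Fin N => α, j ∈ stdSimplex ℝ (Fin N) := by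
  have : Nonempty (Fin N) := ⟨⟨0, hN⟩⟩
  have := isProbabilityMeasure_gammaMeasure hα one_pos
  rw [dirichletMeasure, ae_map_iff measurable_normalize.aemeasurable
    (p := fun j => j ∈ stdSimplex ℝ (Fin N)) (isClosed_stdSimplex ℝ (Fin N)).measurableSet]
  filter_upwards [ae_pi_gammaMeasure_pos hα] with g hg
  have hS : 0 < ∑ j, g j := Finset.sum_pos (fun i _ => hg i) Finset.univ_nonempty
  exact ⟨fun i => (div_pos (hg i) hS).le, by rw [← Finset.sum_div, div_self hS.ne']⟩

/-- This replaces the random denominator by a constant `s`. If the total is at least `s / 2`, the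
denominator loses at most a factor 4. Otherwise the left side is at most 1, while the deviation from
`s` is at least `s / 2`. -/
lemma sum_div_sq_le {ι : Type*} [Fintype ι] {g : ι → ℝ} (hg : ∀ i, 0 ≤ g i) {s : ℝ}
    (hs : 0 < s) :
    ∑ i, (g i / ∑ j, g j) ^ 2 ≤ 4 / s ^ 2 * (∑ i, g i ^ 2 + (∑ i, g i - s) ^ 2) := by
  set S := ∑ j, g j with hS
  have hS0 : 0 ≤ S := Finset.sum_nonneg fun i _ => hg i
  have hQ : 0 ≤ ∑ i, g i ^ 2 := Finset.sum_nonneg fun i _ => sq_nonneg _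
  have hQS : ∑ i, g i ^ 2 ≤ S ^ 2 := Finset.sum_sq_le_sq_sum_of_nonneg fun i _ => hg i
  have e : ∑ i, (g i / S) ^ 2 = (∑ i, g i ^ 2) / S ^ 2 := by
    simp only [div_pow, Finset.sum_div]
  rw [e, div_mul_eq_mul_div]
  rcases le_total (s / 2) S with h | h
  · have hSp : 0 < S := by linarith
    rw [div_le_div_iff₀ (by positivity) (by positivity)]
    have h4 : s ^ 2 ≤ 4 * S ^ 2 := by nlinarith
    nlinarith [mul_nonneg (sq_nonneg (S - s)) (sq_nonneg S), mul_le_mul_of_nonneg_left h4 hQ]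
  · have h1 : (∑ i, g i ^ 2) / S ^ 2 ≤ 1 := div_le_one_of_le₀ hQS (sq_nonneg _)
    refine h1.trans ?_
    rw [le_div_iff₀ (by positivity)]
    nlinarith

/-- Take `s = N * α`, the mean of the gamma total, in `sum_div_sq_le`: the deviation term integrates
to the variance `N * α` of the total, and the squares to `N * α * (α + 1)`. -/
lemma integral_sum_sq_dirichletMeasure_le (hN : 0 < N) (hα : 0 < α) :
    ∫ j, ∑ i, j i ^ 2 ∂(dirichletMeasure fun _ : Fin N => α) ≤ 4 / N + 8 / (N * α) := by
  have hN' : (0 : ℝ) < N := by exact_mod_cast hN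
  have := isProbabilityMeasure_gammaMeasure hα one_pos
  set π := Measure.pi fun _ : Fin N => gammaMeasure α 1 with hπ
  have hmp : ∀ i, MeasurePreserving (Function.eval i) π (gammaMeasure α 1) :=
    fun i => measurePreserving_eval (fun _ : Fin N => gammaMeasure α 1) i
  have hL : ∀ i, MemLp (fun g : Fin N → ℝ => g i) 2 π := fun i =>
    (memLp_id_gammaMeasure hα).comp_measurePreserving (hmp i)
  have hmean : ∀ i, ∫ g : Fin N → ℝ, g i ∂π = α := fun i => by
    rw [← integral_id_gammaMeasure hα, ← (hmp i).map_eq,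
      integral_map (f := fun x => x)
      (hmp i).measurable.aemeasurable measurable_id.aestronglyMeasurable]
  have hsq : ∀ i, ∫ g : Fin N → ℝ, g i ^ 2 ∂π = α * (α + 1) := fun i => by
    rw [← integral_sq_gammaMeasure hα, ← (hmp i).map_eq,
      integral_map (f := fun x => x ^ 2) (hmp i).measurable.aemeasurable
        (measurable_id.pow_const 2).aestronglyMeasurable]
  have hLS : MemLp (fun g : Fin N → ℝ => ∑ i, g i) 2 π := memLp_finsetSum _ fun i _ => hL i
  have hES : ∫ g : Fin N → ℝ, ∑ i, g i ∂π = N * α := by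
    rw [integral_finsetSum _ fun i _ => (hL i).integrable (by norm_num)]
    simp [hmean]
  have hvar : ∫ g : Fin N → ℝ, (∑ i, g i - N * α) ^ 2 ∂π = N * α := by
    have h := variance_sum_pi (μ := fun _ : Fin N => gammaMeasure α 1)
      (X := fun _ x => x) fun _ => memLp_id_gammaMeasure hα
    rw [variance_eq_integral (by
      exact (Finset.univ.aemeasurable_sum fun i _ => (measurable_pi_apply i).aemeasurable))] at h
    simp only [variance_id_gammaMeasure hα, Finset.sum_const, Finset.card_univ,
      Fintype.card_fin, nsmul_eq_mul, Finset.sum_apply] at h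
    rw [← hπ, hES] at h
    exact h
  have hi1 : Integrable (fun g : Fin N → ℝ => ∑ i, g i ^ 2) π :=
    integrable_finsetSum _ fun i _ => (hL i).integrable_sq
  have hi2 : Integrable (fun g : Fin N → ℝ => (∑ i, g i - N * α) ^ 2) π :=
    (hLS.sub (memLp_const _)).integrable_sq
  rw [dirichletMeasure, integral_map measurable_normalize.aemeasurable
    (Finset.measurable_sum _ fun i _ =>
      (measurable_pi_apply i).pow_const 2).aestronglyMeasurable]
  calc ∫ g : Fin N → ℝ, ∑ i, (g i / ∑ j, g j) ^ 2 ∂π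
      ≤ ∫ g : Fin N → ℝ, 4 / (N * α) ^ 2 * (∑ i, g i ^ 2 + (∑ i, g i - N * α) ^ 2) ∂π := by
        refine integral_mono_of_nonneg (ae_of_all _ fun g =>
          Finset.sum_nonneg fun i _ => sq_nonneg _) ((hi1.add hi2).const_mul _) ?_
        filter_upwards [ae_pi_gammaMeasure_pos hα] with g hg
        exact sum_div_sq_le (fun i => (hg i).le) (by positivity)
    _ = 4 / (N * α) ^ 2 * (N * (α * (α + 1)) + N * α) := by
        rw [integral_const_mul, integral_add hi1 hi2, hvar,
          integral_finsetSum _ fun i _ => (hL i).integrable_sq]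
        simp [hsq]
    _ = 4 / N + 8 / (N * α) := by
        field_simp
        ring

end Dirichlet

/-! ### Random weights independent of random locations -/

section WeightedSample

variable {Ω : Type*} [MeasurableSpace Ω] {P : Measure Ω}
  {E : Type*} [MeasurableSpace E]

/-- A random probability vector `j` together with random locations `x`, independent of `j` and with
common marginal law `M`. -/
structure IsWeightedSample (P : Measure Ω) {N : ℕ} (j : Ω → Fin N → ℝ) (x : Ω → Fin N → E)
    (M : Measure E) : Prop where
  aemeasurable_weights : AEMeasurable j P
  weights_mem : ∀ᵐ ω ∂P, j ω ∈ stdSimplex ℝ (Fin N)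
  indep : IndepFun j x P
  law : ∀ i, HasLaw (fun ω => x ω i) M P

namespace IsWeightedSample

variable {N : ℕ} {j : Ω → Fin N → ℝ} {x : Ω → Fin N → E} {M : Measure E}

lemma aemeasurable_weight (h : IsWeightedSample P j x M) (i : Fin N) :
    AEMeasurable (fun ω => j ω i) P :=
  (measurable_pi_apply i).comp_aemeasurable h.aemeasurable_weights

lemma ae_abs_weight_le_one (h : IsWeightedSample P j x M) (i : Fin N) :
    ∀ᵐ ω ∂P, ‖j ω i‖ ≤ 1 := by
  filter_upwards [h.weights_mem] with ω hω
  rw [Real.norm_eq_abs, abs_of_nonneg (hω.1 i), ← hω.2]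
  exact Finset.single_le_sum (fun k _ => hω.1 k) (Finset.mem_univ i)

lemma integrable_weight [IsFiniteMeasure P] (h : IsWeightedSample P j x M) (i : Fin N) :
    Integrable (fun ω => j ω i) P :=
  Integrable.of_bound (h.aemeasurable_weight i).aestronglyMeasurable 1 (h.ae_abs_weight_le_one i)

lemma integrable_weight_mul [IsFiniteMeasure P] (h : IsWeightedSample P j x M) (i k : Fin N) :
    Integrable (fun ω => j ω i * j ω k) P :=
  (h.integrable_weight k).bdd_mul (h.aemeasurable_weight i).aestronglyMeasurable
    (h.ae_abs_weight_le_one i)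

lemma integral_sum_weight [IsProbabilityMeasure P] (h : IsWeightedSample P j x M) :
    ∑ i, ∫ ω, j ω i ∂P = 1 := by
  rw [← integral_finsetSum _ fun i _ => h.integrable_weight i,
    integral_congr_ae (g := fun _ => (1 : ℝ)) (h.weights_mem.mono fun ω hω => hω.2)]
  simp

lemma integrable_comp (h : IsWeightedSample P j x M) {g : E → ℝ} (hg : Integrable g M)
    (i : Fin N) : Integrable (fun ω => g (x ω i)) P := by
  rw [← (h.law i).map_eq] at hg
  exact hg.comp_aemeasurable (h.law i).aemeasurable

lemma integral_comp (h : IsWeightedSample P j x M) {g : E → ℝ} (hg : Integrable g M)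
    (i : Fin N) : ∫ ω, g (x ω i) ∂P = ∫ y, g y ∂M := by
  rw [← (h.law i).map_eq, integral_map (h.law i).aemeasurable]
  rw [(h.law i).map_eq]
  exact hg.aestronglyMeasurable

lemma integrable_sum [IsFiniteMeasure P] (h : IsWeightedSample P j x M) {g : E → ℝ}
    (hg : Integrable g M) : Integrable (fun ω => ∑ i, j ω i * g (x ω i)) P :=
  integrable_finsetSum _ fun i _ => (h.integrable_comp hg i).bdd_mul
    (h.aemeasurable_weight i).aestronglyMeasurable (h.ae_abs_weight_le_one i)

lemma integral_sum [IsProbabilityMeasure P] (h : IsWeightedSample P j x M) {g : E → ℝ}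
    (hgm : Measurable g) (hg : Integrable g M) :
    ∫ ω, ∑ i, j ω i * g (x ω i) ∂P = ∫ y, g y ∂M := by
  rw [integral_finsetSum _ fun i _ => (h.integrable_comp hg i).bdd_mul
    (h.aemeasurable_weight i).aestronglyMeasurable (h.ae_abs_weight_le_one i)]
  have hi : ∀ i, ∫ ω, j ω i * g (x ω i) ∂P = (∫ ω, j ω i ∂P) * ∫ y, g y ∂M := fun i => by
    have hind : IndepFun (fun ω => j ω i) (fun ω => g (x ω i)) P :=
      h.indep.comp (measurable_pi_apply i) (hgm.comp (measurable_pi_apply i))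
    rw [hind.integral_fun_mul_eq_mul_integral (h.aemeasurable_weight i).aestronglyMeasurable
      (h.integrable_comp hg i).aestronglyMeasurable, h.integral_comp hg]
  simp only [hi]
  rw [← Finset.sum_mul, h.integral_sum_weight, one_mul]

/-- Expand the square and factor each expectation by independence of weights and locations. Diagonal
terms are controlled by `|z| ≤ 1`, the others by `q`; the total weight 1 makes the coefficients of
`q` sum to 1. No independence among the locations is needed. -/
lemma integral_sq_sum_le [IsProbabilityMeasure P] (h : IsWeightedSample P j x M) {z : E → ℝ}
    (hz : Measurable z) (hz1 : ∀ y, |z y| ≤ 1) {q : ℝ}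
    (hq : ∀ i k, i ≠ k → ∫ ω, z (x ω i) * z (x ω k) ∂P ≤ q) (hq0 : 0 ≤ q) :
    ∫ ω, (∑ i, j ω i * z (x ω i)) ^ 2 ∂P ≤ ∫ ω, ∑ i, j ω i ^ 2 ∂P + q := by
  have hzm : ∀ i, AEStronglyMeasurable (fun ω => z (x ω i)) P := fun i =>
    (hz.comp_aemeasurable (h.law i).aemeasurable).aestronglyMeasurable
  have hzz : ∀ i k, AEStronglyMeasurable (fun ω => z (x ω i) * z (x ω k)) P := fun i k =>
    (hzm i).mul (hzm k)
  have hzz1 : ∀ i k, ∀ ω, |z (x ω i) * z (x ω k)| ≤ 1 := fun i k ω => by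
    rw [abs_mul]
    exact mul_le_one₀ (hz1 _) (abs_nonneg _) (hz1 _)
  have hint : ∀ i k, Integrable (fun ω => j ω i * j ω k * (z (x ω i) * z (x ω k))) P :=
    fun i k => (h.integrable_weight_mul i k).mul_bdd (c := 1) (hzz i k)
      (ae_of_all _ fun ω => hzz1 i k ω)
  -- The term with `q` is granted to the diagonal as well, so that its coefficients run over all
  -- pairs and sum to 1.
  have hterm : ∀ i k, ∫ ω, j ω i * j ω k * (z (x ω i) * z (x ω k)) ∂P ≤
      (if i = k then ∫ ω, j ω i ^ 2 ∂P else 0) + (∫ ω, j ω i * j ω k ∂P) * q := fun i k => by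
    have hind : IndepFun (fun ω => j ω i * j ω k) (fun ω => z (x ω i) * z (x ω k)) P :=
      h.indep.comp (φ := fun w : Fin N → ℝ => w i * w k)
        (ψ := fun y : Fin N → E => z (y i) * z (y k))
        ((measurable_pi_apply i).mul (measurable_pi_apply k))
        ((hz.comp (measurable_pi_apply i)).mul (hz.comp (measurable_pi_apply k)))
    have hJ0 : 0 ≤ ∫ ω, j ω i * j ω k ∂P := integral_nonneg_of_ae <| by
      filter_upwards [h.weights_mem] with ω hω
      exact mul_nonneg (hω.1 i) (hω.1 k)
    rw [hind.integral_fun_mul_eq_mul_integral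
      (h.integrable_weight_mul i k).aestronglyMeasurable (hzz i k)]
    split_ifs with hik
    · subst hik
      have h1 : ∫ ω, z (x ω i) * z (x ω i) ∂P ≤ 1 := by
        have := integral_mono_of_nonneg (μ := P)
          (ae_of_all _ fun ω => mul_self_nonneg (z (x ω i))) (integrable_const (1 : ℝ))
          (ae_of_all _ fun ω => (le_abs_self _).trans (hzz1 i i ω))
        simpa using this
      have h2 := mul_le_mul_of_nonneg_left h1 hJ0
      simp only [sq]
      nlinarith [mul_nonneg hJ0 hq0]
    · rw [zero_add]
      exact mul_le_mul_of_nonneg_left (hq i k hik) hJ0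
  have hexp : ∀ ω, (∑ i, j ω i * z (x ω i)) ^ 2 =
      ∑ i, ∑ k, j ω i * j ω k * (z (x ω i) * z (x ω k)) := fun ω => by
    rw [sq, Finset.sum_mul_sum]
    exact Finset.sum_congr rfl fun i _ => Finset.sum_congr rfl fun k _ => by ring
  have hJJ : ∑ i, ∑ k, ∫ ω, j ω i * j ω k ∂P = 1 := by
    simp only [← integral_finsetSum _ fun k (_ : k ∈ Finset.univ) => h.integrable_weight_mul _ k]
    rw [← integral_finsetSum _ fun i _ =>
      integrable_finsetSum _ fun k _ => h.integrable_weight_mul i k,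
      integral_congr_ae (g := fun _ => (1 : ℝ)) ?_]
    · simp
    · filter_upwards [h.weights_mem] with ω hω
      rw [← Finset.sum_mul_sum, hω.2, one_mul]
  simp only [hexp]
  rw [integral_finsetSum _ fun i _ => integrable_finsetSum _ fun k _ => hint i k]
  simp only [integral_finsetSum _ fun k (_ : k ∈ Finset.univ) => hint _ k]
  calc ∑ i, ∑ k, ∫ ω, j ω i * j ω k * (z (x ω i) * z (x ω k)) ∂P
      ≤ ∑ i, ∑ k, ((if i = k then ∫ ω, j ω i ^ 2 ∂P else 0) + (∫ ω, j ω i * j ω k ∂P) * q) :=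
        Finset.sum_le_sum fun i _ => Finset.sum_le_sum fun k _ => hterm i k
    _ = ∑ i, ∫ ω, j ω i ^ 2 ∂P + (∑ i, ∑ k, ∫ ω, j ω i * j ω k ∂P) * q := by
        simp [Finset.sum_add_distrib, Finset.sum_mul]
    _ = ∫ ω, ∑ i, j ω i ^ 2 ∂P + q := by
        rw [hJJ, one_mul, integral_finsetSum]
        exact fun i _ => by simpa only [sq] using h.integrable_weight_mul i i

lemma integral_abs_sum_le [IsProbabilityMeasure P] (h : IsWeightedSample P j x M) {z : E → ℝ}
    (hz : Measurable z) (hz1 : ∀ y, |z y| ≤ 1) {q : ℝ}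
    (hq : ∀ i k, i ≠ k → ∫ ω, z (x ω i) * z (x ω k) ∂P ≤ q) (hq0 : 0 ≤ q) :
    ∫ ω, |∑ i, j ω i * z (x ω i)| ∂P ≤ √(∫ ω, ∑ i, j ω i ^ 2 ∂P + q) := by
  set S : Ω → ℝ := fun ω => |∑ i, j ω i * z (x ω i)| with hS
  have hSm : AEMeasurable S P := (Finset.aemeasurable_fun_sum _ fun i _ =>
    (h.aemeasurable_weight i).mul (hz.comp_aemeasurable (h.law i).aemeasurable)).abs
  have hSb : ∀ᵐ ω ∂P, ‖S ω‖ ≤ 1 := by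
    filter_upwards [h.weights_mem] with ω hω
    rw [hS, Real.norm_eq_abs, abs_abs]
    refine (Finset.abs_sum_le_sum_abs _ _).trans ?_
    rw [← hω.2]
    refine Finset.sum_le_sum fun i _ => ?_
    rw [abs_mul, abs_of_nonneg (hω.1 i)]
    exact mul_le_of_le_one_right (hω.1 i) (hz1 _)
  have hL : MemLp S 2 P := MemLp.of_bound hSm.aestronglyMeasurable 1 hSb
  -- Nonnegativity of the variance of `S` is the inequality `(E S) ^ 2 ≤ E (S ^ 2)`.
  have hvar := variance_eq_sub hL
  have hnn := variance_nonneg S P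
  have hle := h.integral_sq_sum_le hz hz1 hq hq0
  refine Real.le_sqrt_of_sq_le ?_
  have hsq : ∫ ω, (S ^ 2) ω ∂P = ∫ ω, (∑ i, j ω i * z (x ω i)) ^ 2 ∂P := by
    simp only [hS, Pi.pow_apply, sq_abs]
  linarith

end IsWeightedSample

end WeightedSample

/-! ### Integrable error bound uniform over 1-Lipschitz functions -/

section UniformBound

variable {Ω : Type*} [MeasurableSpace Ω] {P : Measure Ω}
  {E : Type*} [NormedAddCommGroup E] [MeasurableSpace E] [BorelSpace E]
  [SecondCountableTopology E]
  {N : ℕ} {j : Ω → Fin N → ℝ} {x : Ω → Fin N → E} {M ν : Measure E}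

lemma abs_weighted_sum_sub_integral_le [IsProbabilityMeasure ν]
    (hν : Integrable (fun y => ‖y‖) ν) (T : SimpleFunc E E) {w : Fin N → ℝ}
    (hw : w ∈ stdSimplex ℝ (Fin N)) (y : Fin N → E) {f : E → ℝ} (hf : LipschitzWith 1 f) :
    |∑ i, w i * f (y i) - ∫ u, f u ∂ν| ≤
      ∑ i, w i * ‖y i - T (y i)‖ + ∫ u, ‖u - T u‖ ∂ν + ∑ c ∈ T.range, ‖c‖ *
        |∑ i, w i * ((T ⁻¹' {c}).indicator 1 (y i) - ν.real (T ⁻¹' {c}))| := by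
  set μ : Measure E := ∑ i, ENNReal.ofReal (w i) • Measure.dirac (y i) with hμ
  have hprob : IsProbabilityMeasure μ := ⟨by
    simp only [hμ, Measure.finsetSum_apply, Measure.smul_apply, measure_univ, smul_eq_mul, mul_one]
    rw [← ENNReal.ofReal_sum_of_nonneg fun i _ => hw.1 i, hw.2, ENNReal.ofReal_one]⟩
  have hid : ∀ g : E → ℝ, ∀ i ∈ Finset.univ,
      Integrable g (ENNReal.ofReal (w i) • Measure.dirac (y i)) := fun g i _ =>
    (integrable_dirac (by simp)).smul_measure ENNReal.ofReal_ne_top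
  have hi : ∀ g : E → ℝ, ∫ u, g u ∂μ = ∑ i, w i * g (y i) := fun g => by
    rw [hμ, integral_finsetSum_measure (hid g)]
    simp [integral_smul_measure, ENNReal.toReal_ofReal (hw.1 _)]
  have hint : Integrable (fun u => ‖u‖) μ := integrable_finsetSum_measure.2 (hid _)
  have h := abs_integral_sub_le_discretizationError hint hν T hf
  rw [discretizationError, hi, hi] at h
  refine h.trans_eq ?_
  congr 1
  refine Finset.sum_congr rfl fun c _ => ?_
  rw [← integral_indicator_one (T.measurableSet_fiber c), hi]
  simp only [mul_sub, Finset.sum_sub_distrib, ← Finset.sum_mul, hw.2, one_mul]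

/-- A single integrable `R` serves all `f`, so Markov's inequality can be applied to `R` and
measurability of a supremum over an arbitrary family never matters. The test functions in `hq` are
centred under the target `ν`, not under the marginal `M`, so `q` has to absorb the bias between the
two. -/
lemma IsWeightedSample.exists_uniform_bound [IsProbabilityMeasure P] [IsProbabilityMeasure ν]
    [IsFiniteMeasure M] (h : IsWeightedSample P j x M) (hM : Integrable (fun y => ‖y‖) M)
    (hν : Integrable (fun y => ‖y‖) ν) {q : ℝ} (hq0 : 0 ≤ q)
    (hq : ∀ z : E → ℝ, Measurable z → (∀ y, |z y| ≤ 1) → ∫ y, z y ∂ν = 0 →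
      ∀ i k, i ≠ k → ∫ ω, z (x ω i) * z (x ω k) ∂P ≤ q) (T : SimpleFunc E E) :
    ∃ R : Ω → ℝ, Integrable R P ∧
      ∫ ω, R ω ∂P ≤ ∫ y, ‖y - T y‖ ∂M + ∫ y, ‖y - T y‖ ∂ν +
        (∑ c ∈ T.range, ‖c‖) * √(∫ ω, ∑ i, j ω i ^ 2 ∂P + q) ∧
      ∀ᵐ ω ∂P, ∀ f : E → ℝ, LipschitzWith 1 f →
        |∑ i, j ω i * f (x ω i) - ∫ y, f y ∂ν| ≤ R ω := by
  set z : E → E → ℝ := fun c y => (T ⁻¹' {c}).indicator 1 y - ν.real (T ⁻¹' {c}) with hz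
  have hzm : ∀ c, Measurable (z c) := fun c =>
    (measurable_one.indicator (T.measurableSet_fiber c)).sub_const _
  have hz1 : ∀ c y, |z c y| ≤ 1 := fun c y => by
    have h0 : 0 ≤ ν.real (T ⁻¹' {c}) := measureReal_nonneg
    have h1 : ν.real (T ⁻¹' {c}) ≤ 1 := measureReal_le_one
    rcases Set.indicator_eq_zero_or_self (T ⁻¹' {c}) (1 : E → ℝ) y with e | e <;>
      simp only [hz, e, Pi.one_apply] <;> rw [abs_le] <;> constructor <;> linarith
  have hz0 : ∀ c, ∫ y, z c y ∂ν = 0 := fun c => by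
    simp only [hz]
    rw [integral_sub (f := fun y => (T ⁻¹' {c}).indicator 1 y)
      ((integrable_const (1 : ℝ)).indicator (T.measurableSet_fiber c)) (integrable_const _),
      integral_indicator_one (T.measurableSet_fiber c)]
    simp
  have hzi : ∀ c, Integrable (z c) M := fun c =>
    Integrable.of_bound (hzm c).aestronglyMeasurable 1 (ae_of_all _ (hz1 c))
  have hgi := integrable_norm_sub_simpleFunc hM T
  have hgm : Measurable fun y : E => ‖y - T y‖ := (measurable_id.sub T.measurable).norm
  have hi1 : Integrable (fun ω => ∑ i, j ω i * ‖x ω i - T (x ω i)‖ + ∫ y, ‖y - T y‖ ∂ν) P :=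
    (h.integrable_sum hgi).add (integrable_const (∫ y, ‖y - T y‖ ∂ν))
  have hi2 : ∀ c ∈ T.range, Integrable (fun ω => ‖c‖ * |∑ i, j ω i * z c (x ω i)|) P :=
    fun c _ => (h.integrable_sum (hzi c)).abs.const_mul _
  refine ⟨fun ω => ∑ i, j ω i * ‖x ω i - T (x ω i)‖ + ∫ u, ‖u - T u‖ ∂ν +
    ∑ c ∈ T.range, ‖c‖ * |∑ i, j ω i * z c (x ω i)|,
    hi1.add (integrable_finsetSum _ hi2), ?_, ?_⟩
  · dsimp only
    rw [integral_add hi1 (integrable_finsetSum _ hi2),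
      integral_add (h.integrable_sum hgi) (integrable_const _), h.integral_sum hgm hgi,
      integral_finsetSum _ hi2, Finset.sum_mul]
    simp only [integral_const, probReal_univ, one_smul, integral_const_mul]
    gcongr with c hc
    exact h.integral_abs_sum_le (hzm c) (hz1 c) (hq _ (hzm c) (hz1 c) (hz0 c)) hq0
  · filter_upwards [h.weights_mem] with ω hω f hf
    exact abs_weighted_sum_sub_integral_le hν T hω (x ω) hf

end UniformBound

/-! ### Empirical means of i.i.d. samples -/

section Empirical

variable {Ω : Type*} [MeasurableSpace Ω] {P : Measure Ω} [IsProbabilityMeasure P]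
  {E : Type*} [MeasurableSpace E] {F : Measure E} {X : ℕ → Ω → E}

omit [IsProbabilityMeasure P] in
lemma integral_mul_eq_zero_of_iid (hlaw : ∀ i, HasLaw (X i) F P) (hind : iIndepFun X P)
    {z : E → ℝ} (hz : Measurable z) (hz0 : ∫ y, z y ∂F = 0) {i k : ℕ} (hik : i ≠ k) :
    ∫ ω, z (X i ω) * z (X k ω) ∂P = 0 := by
  have h : IndepFun (fun ω => z (X i ω)) (fun ω => z (X k ω)) P :=
    (hind.indepFun hik).comp hz hz
  have hm : ∀ i, AEStronglyMeasurable (fun ω => z (X i ω)) P := fun i =>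
    (hz.comp_aemeasurable (hlaw i).aemeasurable).aestronglyMeasurable
  have h0 : ∫ ω, z (X i ω) ∂P = 0 := by
    rw [← hz0, ← (hlaw i).map_eq, integral_map (hlaw i).aemeasurable hz.aestronglyMeasurable]
  rw [h.integral_fun_mul_eq_mul_integral (hm i) (hm k), h0, zero_mul]

/-- Constant weights are independent of everything, so the weighted estimates cover ordinary
empirical measures, both of the data and of the generated sample. -/
lemma isWeightedSample_iid (hlaw : ∀ i, HasLaw (X i) F P) {N : ℕ} (hN : 0 < N) :
    IsWeightedSample P (fun _ (_ : Fin N) => (N : ℝ)⁻¹) (fun ω (i : Fin N) => X i ω) F where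
  aemeasurable_weights := aemeasurable_const
  weights_mem := ae_of_all _ fun _ => ⟨fun _ => by positivity, by
    simp [mul_inv_cancel₀ (show (N : ℝ) ≠ 0 by exact_mod_cast hN.ne')]⟩
  indep := indepFun_const_left _ _
  law i := hlaw i

omit [MeasurableSpace Ω] in
lemma sum_sq_inv {N : ℕ} (hN : 0 < N) : ∑ _i : Fin N, ((N : ℝ)⁻¹) ^ 2 = (N : ℝ)⁻¹ := by
  have : (N : ℝ) ≠ 0 := by exact_mod_cast hN.ne'
  simp only [Finset.sum_const, Finset.card_univ, Fintype.card_fin, nsmul_eq_mul]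
  field_simp

lemma integral_sq_mean_le (hlaw : ∀ i, HasLaw (X i) F P) (hind : iIndepFun X P) {n : ℕ}
    (hn : 0 < n) {z : E → ℝ} (hz : Measurable z) (hz1 : ∀ y, |z y| ≤ 1)
    (hz0 : ∫ y, z y ∂F = 0) :
    ∫ ω, (∑ i : Fin n, (n : ℝ)⁻¹ * z (X i ω)) ^ 2 ∂P ≤ (n : ℝ)⁻¹ := by
  have h := (isWeightedSample_iid hlaw hn).integral_sq_sum_le hz hz1 (q := 0)
    (fun i k hik => (integral_mul_eq_zero_of_iid hlaw hind hz hz0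
      (fun h => hik (Fin.ext h))).le) le_rfl
  simpa only [sum_sq_inv hn, integral_const, probReal_univ, one_smul, add_zero] using h

end Empirical

/-! ### Locations drawn from the posterior base measure -/

section Posterior

variable {E : Type*} [MeasurableSpace E] {n N : ℕ} {a : ℝ}

lemma isProbabilityMeasure_empirical (hn : 0 < n) (x : Fin n → E) :
    IsProbabilityMeasure (empirical x) := ⟨by
  simp only [empirical, Measure.smul_apply, Measure.finsetSum_apply, measure_univ,
    Finset.sum_const, Finset.card_univ, Fintype.card_fin, nsmul_eq_mul, mul_one, smul_eq_mul]
  exact ENNReal.inv_mul_cancel (by exact_mod_cast hn.ne') (ENNReal.natCast_ne_top n)⟩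

lemma ofReal_add_ofReal_mixture (ha : 0 < a) (n : ℕ) :
    ENNReal.ofReal (a / (a + n)) + ENNReal.ofReal (n / (a + n)) = 1 := by
  rw [← ENNReal.ofReal_add (by positivity) (by positivity), ← add_div, div_self (by positivity),
    ENNReal.ofReal_one]

lemma isProbabilityMeasure_mixture (ha : 0 < a) (n : ℕ) (H F : Measure E)
    [IsProbabilityMeasure H] [IsProbabilityMeasure F] :
    IsProbabilityMeasure
      (ENNReal.ofReal (a / (a + n)) • H + ENNReal.ofReal (n / (a + n)) • F) := ⟨by
  simp only [Measure.add_apply, Measure.smul_apply, measure_univ, smul_eq_mul, mul_one,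
    ofReal_add_ofReal_mixture ha n]⟩

lemma isProbabilityMeasure_posteriorBase (ha : 0 < a) (hn : 0 < n) (H : Measure E)
    [IsProbabilityMeasure H] (x : Fin n → E) : IsProbabilityMeasure (posteriorBase a H x) :=
  have := isProbabilityMeasure_empirical hn x
  isProbabilityMeasure_mixture ha n H (empirical x)

lemma isMarkovKernel_posteriorLocations (ha : 0 < a) (hn : 0 < n) (N : ℕ) (H : Measure E)
    [IsProbabilityMeasure H] : IsMarkovKernel (posteriorLocations n N a H) := ⟨fun x => by
  have := isProbabilityMeasure_posteriorBase ha hn H x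
  exact inferInstanceAs (IsProbabilityMeasure (Measure.pi fun _ : Fin N => posteriorBase a H x))⟩

lemma integral_posteriorBase [MeasurableSingletonClass E] (ha : 0 < a) (H : Measure E)
    [IsProbabilityMeasure H] (x : Fin n → E) {z : E → ℝ} (hz : Integrable z H) :
    ∫ y, z y ∂posteriorBase a H x =
      a / (a + n) * ∫ y, z y ∂H + n / (a + n) * ∑ i, (n : ℝ)⁻¹ * z (x i) := by
  have hi : ∀ i ∈ Finset.univ, Integrable z (Measure.dirac (x i)) := fun i _ =>
    integrable_dirac (by simp)
  have he : Integrable z (empirical x) := by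
    rcases Nat.eq_zero_or_pos n with rfl | hn
    · simp [empirical]
    · exact (integrable_finsetSum_measure.2 hi).smul_measure
        (ENNReal.inv_ne_top.2 (by exact_mod_cast hn.ne'))
  have he' : ∫ y, z y ∂empirical x = ∑ i, (n : ℝ)⁻¹ * z (x i) := by
    rw [empirical, integral_smul_measure, integral_finsetSum_measure hi]
    simp [Finset.mul_sum]
  rw [posteriorBase, integral_add_measure (hz.smul_measure ENNReal.ofReal_ne_top)
    (he.smul_measure ENNReal.ofReal_ne_top), integral_smul_measure, integral_smul_measure, he',
    ENNReal.toReal_ofReal (by positivity), ENNReal.toReal_ofReal (by positivity)]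
  rfl

variable {Ω : Type*} [MeasurableSpace Ω] {P : Measure Ω} [IsProbabilityMeasure P]
  {F : Measure E} {H : Measure E} [IsProbabilityMeasure H]
  {X : ℕ → Ω → E} {Z : Ω → Fin N → E}

/-- Given the data, each location has law `H*`. Averaging over the data turns every Dirac mass at `X
k` into `F`. -/
lemma hasLaw_posteriorLocation (ha : 0 < a) (hn : 0 < n) (hlaw : ∀ i, HasLaw (X i) F P)
    (hZ : HasCondDistrib Z (fun ω (i : Fin n) => X i ω) (posteriorLocations n N a H) P)
    (i : Fin N) :
    HasLaw (fun ω => Z ω i)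
      (ENNReal.ofReal (a / (a + n)) • H + ENNReal.ofReal (n / (a + n)) • F) P where
  aemeasurable := (measurable_pi_apply i).comp_aemeasurable hZ.aemeasurable_snd
  map_eq := by
    have hZi : AEMeasurable (fun ω => Z ω i) P :=
      (measurable_pi_apply i).comp_aemeasurable hZ.aemeasurable_snd
    have := isMarkovKernel_posteriorLocations ha hn N H
    ext s hs
    have hX := hZ.aemeasurable_fst
    have hpre : MeasurableSet {p : (Fin n → E) × (Fin N → E) | p.2 i ∈ s} :=
      (measurable_pi_apply i).comp measurable_snd hs
    have h1 : P.map (fun ω => Z ω i) s = ∫⁻ ω, posteriorBase a H (fun k : Fin n => X k ω) s ∂P := by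
      rw [Measure.map_apply_of_aemeasurable hZi hs]
      have h2 := hZ.measure_eq (p := fun p => p.2 i ∈ s) hpre
      refine h2.trans ?_
      rw [Measure.compProd_apply hpre, lintegral_map' (Kernel.measurable_kernel_prodMk_left hpre
        ).aemeasurable hX]
      refine lintegral_congr fun ω => ?_
      have := isProbabilityMeasure_posteriorBase ha hn H fun k : Fin n => X k ω
      exact (measurePreserving_eval (fun _ : Fin N => posteriorBase a H fun k : Fin n => X k ω) i
        ).measure_preimage hs.nullMeasurableSet
    have hm : ∀ k : ℕ, AEMeasurable (fun ω => Measure.dirac (X k ω) s) P := fun k =>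
      ((Measure.measurable_coe hs).comp Measure.measurable_dirac).comp_aemeasurable
        (hlaw k).aemeasurable
    have h3 : ∀ k : ℕ, ∫⁻ ω, Measure.dirac (X k ω) s ∂P = F s := fun k => by
      rw [← (hlaw k).map_eq, ← lintegral_map' (f := fun y => Measure.dirac y s)
        ((Measure.measurable_coe hs).comp Measure.measurable_dirac).aemeasurable
        (hlaw k).aemeasurable]
      simp [Measure.dirac_apply' _ hs, lintegral_indicator_one hs]
    have hn0 : (n : ℝ≥0∞) ≠ 0 := by exact_mod_cast hn.ne'
    rw [h1]
    simp only [posteriorBase, empirical, Measure.add_apply, Measure.smul_apply, smul_eq_mul,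
      Measure.finsetSum_apply]
    rw [lintegral_add_left measurable_const,
      lintegral_const_mul' (ENNReal.ofReal (n / (a + n))) _ ENNReal.ofReal_ne_top,
      lintegral_const_mul' _ _ (ENNReal.inv_ne_top.2 hn0),
      lintegral_finsetSum' _ fun (k : Fin n) _ => hm k]
    simp only [h3, lintegral_const, measure_univ, mul_one, Finset.sum_const, Finset.card_univ,
      Fintype.card_fin, nsmul_eq_mul]
    rw [← mul_assoc (n : ℝ≥0∞)⁻¹, ENNReal.inv_mul_cancel hn0 (ENNReal.natCast_ne_top n), one_mul]

/-- Distinct locations are conditionally i.i.d., so the conditional expectation is `(∫ z dH*) ^ 2`.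
Here `∫ z dH*` is a prior part of size at most `a / (a + n)` plus at most the empirical mean of `z`,
whose second moment is at most `1 / n` because `z` is centred under `F`. The factors 2 come from `(u
+ v) ^ 2 ≤ 2 * (u ^ 2 + v ^ 2)`. -/
lemma integral_mul_posteriorLocation_le [MeasurableSingletonClass E] (ha : 0 < a) (hn : 0 < n)
    (hlaw : ∀ i, HasLaw (X i) F P) (hind : iIndepFun X P)
    (hZ : HasCondDistrib Z (fun ω (i : Fin n) => X i ω) (posteriorLocations n N a H) P)
    {z : E → ℝ} (hz : Measurable z) (hz1 : ∀ y, |z y| ≤ 1) (hz0 : ∫ y, z y ∂F = 0)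
    {i k : Fin N} (hik : i ≠ k) :
    ∫ ω, z (Z ω i) * z (Z ω k) ∂P ≤ 2 * (a / (a + n)) ^ 2 + 2 * (n : ℝ)⁻¹ := by
  have := isMarkovKernel_posteriorLocations ha hn N H
  have hX := hZ.aemeasurable_fst
  have hprob : IsProbabilityMeasure (P.map fun ω (i : Fin n) => X i ω) :=
    Measure.isProbabilityMeasure_map hX
  have hzz : Measurable fun y : Fin N → E => z (y i) * z (y k) :=
    (hz.comp (measurable_pi_apply i)).mul (hz.comp (measurable_pi_apply k))
  have hzz1 : ∀ y : Fin N → E, ‖z (y i) * z (y k)‖ ≤ 1 := fun y => by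
    rw [Real.norm_eq_abs, abs_mul]
    exact mul_le_one₀ (hz1 _) (abs_nonneg _) (hz1 _)
  have hzH : Integrable z H := Integrable.of_bound hz.aestronglyMeasurable 1 (ae_of_all _ hz1)
  have hu : |∫ y, z y ∂H| ≤ 1 := by
    have := norm_integral_le_of_norm_le_const (μ := H) (f := z) (C := 1) (ae_of_all _ hz1)
    simpa using this
  have hcond : ∀ x : Fin n → E, ∫ y, z (y i) * z (y k) ∂posteriorLocations n N a H x =
      (∫ y, z y ∂posteriorBase a H x) ^ 2 := fun x => by
    have := isProbabilityMeasure_posteriorBase ha hn H x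
    change ∫ y : Fin N → E, z (y i) * z (y k) ∂(Measure.pi fun _ => posteriorBase a H x) = _
    have hI : IndepFun (fun y : Fin N → E => z (y i)) (fun y => z (y k))
        (Measure.pi fun _ => posteriorBase a H x) :=
      (iIndepFun_pi (μ := fun _ : Fin N => posteriorBase a H x) (X := fun _ => z)
        fun _ => hz.aemeasurable).indepFun hik
    have hE : ∀ l : Fin N, ∫ y : Fin N → E, z (y l) ∂(Measure.pi fun _ => posteriorBase a H x) =
        ∫ y, z y ∂posteriorBase a H x := fun l => by
      have hmp := measurePreserving_eval (fun _ : Fin N => posteriorBase a H x) l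
      conv_rhs => rw [← hmp.map_eq]
      rw [integral_map hmp.measurable.aemeasurable hz.aestronglyMeasurable]
    rw [hI.integral_fun_mul_eq_mul_integral
      (hz.comp (measurable_pi_apply i)).aestronglyMeasurable
      (hz.comp (measurable_pi_apply k)).aestronglyMeasurable, hE, hE, sq]
  have hjoint : ∫ ω, z (Z ω i) * z (Z ω k) ∂P =
      ∫ ω, (∫ y, z y ∂posteriorBase a H fun l : Fin n => X l ω) ^ 2 ∂P := by
    have hzz2 : Measurable fun p : (Fin n → E) × (Fin N → E) => z (p.2 i) * z (p.2 k) :=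
      hzz.comp measurable_snd
    have h1 : ∫ ω, z (Z ω i) * z (Z ω k) ∂P =
        ∫ p : (Fin n → E) × (Fin N → E), z (p.2 i) * z (p.2 k)
          ∂(P.map (fun ω (i : Fin n) => X i ω) ⊗ₘ posteriorLocations n N a H) := by
      rw [← hZ.map_eq, integral_map hZ.aemeasurable hzz2.aestronglyMeasurable]
    rw [h1, Measure.integral_compProd (Integrable.of_bound
      hzz2.aestronglyMeasurable 1 (ae_of_all _ fun p => hzz1 p.2))]
    simp only [hcond]
    rw [integral_map hX]
    simp only [integral_posteriorBase ha H _ hzH]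
    exact (by fun_prop : Measurable _).aestronglyMeasurable
  rw [hjoint]
  simp only [integral_posteriorBase ha H _ hzH]
  have hmean := integral_sq_mean_le hlaw hind hn hz hz1 hz0
  have hd0 : 0 ≤ (n : ℝ) / (a + n) := by positivity
  have hd1 : (n : ℝ) / (a + n) ≤ 1 := div_le_one_of_le₀ (by linarith) (by positivity)
  have hSi : Integrable (fun ω => (∑ l : Fin n, (n : ℝ)⁻¹ * z (X l ω)) ^ 2) P := by
    have hS : MemLp (fun ω => ∑ l : Fin n, (n : ℝ)⁻¹ * z (X l ω)) 2 P :=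
      memLp_finsetSum _ fun l _ => (MemLp.of_bound
        (hz.comp_aemeasurable (hlaw l).aemeasurable).aestronglyMeasurable 1
        (ae_of_all _ fun ω => hz1 _)).const_mul _
    exact hS.integrable_sq
  calc ∫ ω, (a / (a + n) * ∫ y, z y ∂H + n / (a + n) * ∑ l : Fin n, (n : ℝ)⁻¹ * z (X l ω)) ^ 2 ∂P
      ≤ ∫ ω, (2 * (a / (a + n)) ^ 2 + 2 * (∑ l : Fin n, (n : ℝ)⁻¹ * z (X l ω)) ^ 2) ∂P := by
        refine integral_mono_of_nonneg (ae_of_all _ fun _ => sq_nonneg _)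
          ((integrable_const _).add (hSi.const_mul _)) (ae_of_all _ fun ω => ?_)
        set S := ∑ l : Fin n, (n : ℝ)⁻¹ * z (X l ω)
        have h1 : (a / (a + n) * ∫ y, z y ∂H) ^ 2 ≤ (a / (a + n)) ^ 2 := by
          rw [mul_pow]
          exact mul_le_of_le_one_right (sq_nonneg _) ((sq_le_one_iff_abs_le_one _).2 hu)
        have h2 : (n / (a + n) * S) ^ 2 ≤ S ^ 2 := by
          rw [mul_pow]
          exact mul_le_of_le_one_left (sq_nonneg _) (pow_le_one₀ hd0 hd1)
        exact (add_sq_le (a := a / (a + n) * ∫ y, z y ∂H) (b := n / (a + n) * S)).trans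
          (by linarith)
    _ = 2 * (a / (a + n)) ^ 2 + 2 * ∫ ω, (∑ l : Fin n, (n : ℝ)⁻¹ * z (X l ω)) ^ 2 ∂P := by
        rw [integral_add (integrable_const _) (hSi.const_mul _), integral_const, integral_const_mul]
        simp only [probReal_univ, one_smul]
    _ ≤ _ := by linarith

end Posterior

/-- Carries a bound uniform in `θ` over to the suprema. Boundedness matters since the real supremum
of an unbounded family is 0 by convention; for `u` it is inherited from `v`. -/
lemma abs_ciSup_sub_ciSup_le {Θ : Type*} [Nonempty Θ] {u v : Θ → ℝ} {B : ℝ}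
    (hv : BddAbove (Set.range v)) (h : ∀ θ, |u θ - v θ| ≤ B) : |(⨆ θ, u θ) - ⨆ θ, v θ| ≤ B := by
  have hu : BddAbove (Set.range u) := by
    obtain ⟨c, hc⟩ := hv
    refine ⟨c + B, ?_⟩
    rintro _ ⟨θ, rfl⟩
    linarith [hc ⟨θ, rfl⟩, (abs_le.1 (h θ)).2]
  rw [abs_le]
  constructor
  · have : ⨆ θ, v θ ≤ (⨆ θ, u θ) + B :=
      ciSup_le fun θ => by linarith [le_ciSup hu θ, (abs_le.1 (h θ)).1]
    linarith
  · have : ⨆ θ, u θ ≤ (⨆ θ, v θ) + B :=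
      ciSup_le fun θ => by linarith [le_ciSup hv θ, (abs_le.1 (h θ)).2]
    linarith

/-! ### Finiteness of the distance and separation of measures -/

section Distance

variable {E : Type*} [NormedAddCommGroup E] [MeasurableSpace E] [BorelSpace E]
  [SecondCountableTopology E] {F G : Measure E} [IsProbabilityMeasure F] [IsProbabilityMeasure G]

lemma bddAbove_range_integral_sub (hF : Integrable (fun x => ‖x‖) F)
    (hG : Integrable (fun x => ‖x‖) G) {Θ : Type*} {D : Θ → E → ℝ}
    (hD : ∀ θ, LipschitzWith 1 (D θ)) :
    BddAbove (Set.range fun θ => ∫ x, D θ x ∂F - ∫ x, D θ x ∂G) := by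
  -- With `T = 0` the error is the sum of the two first moments.
  refine ⟨discretizationError 0 F G, ?_⟩
  rintro _ ⟨θ, rfl⟩
  exact (le_abs_self _).trans (abs_integral_sub_le_discretizationError hF hG 0 (hD θ))

omit [NormedAddCommGroup E] [BorelSpace E] [SecondCountableTopology E] [IsProbabilityMeasure F]
  [IsProbabilityMeasure G] in
lemma discDist_self {Θ : Type*} (D : Θ → E → ℝ) (μ : Measure E) : discDist D μ μ = 0 := by
  simp [discDist]

/-- The class is closed under negation, so a vanishing supremum forces equal integrals. After
rescaling, this holds for all Lipschitz functions. Bounded Lipschitz functions test weak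
convergence, so the constant sequence `F` converges to `G`, and weak limits are unique. -/
lemma eq_of_discDist_allLipschitz_eq_zero (hF : Integrable (fun x => ‖x‖) F)
    (hG : Integrable (fun x => ‖x‖) G) (h : discDist (allLipschitz E) F G = 0) : F = G := by
  have hle : ∀ f : E → ℝ, LipschitzWith 1 f → ∫ x, f x ∂F ≤ ∫ x, f x ∂G := fun f hf => by
    have := le_ciSup (bddAbove_range_integral_sub hF hG (D := allLipschitz E)
      Subtype.property) ⟨f, hf⟩
    rw [← discDist, h] at this
    simpa [allLipschitz] using this
  have heq1 : ∀ f : E → ℝ, LipschitzWith 1 f → ∫ x, f x ∂F = ∫ x, f x ∂G := fun f hf => by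
    refine le_antisymm (hle f hf) ?_
    have := hle (fun x => -f x) hf.neg
    simp only [integral_neg] at this
    linarith
  have heq : ∀ (f : E → ℝ) L, LipschitzWith L f → ∫ x, f x ∂F = ∫ x, f x ∂G := fun f L hf => by
    -- Dividing by `L + 1` rather than `L` covers `L = 0`.
    have hL : (0 : ℝ) < L + 1 := by positivity
    have h1 := heq1 (fun x => ((L : ℝ) + 1)⁻¹ * f x) <| LipschitzWith.of_dist_le_mul fun x y => by
      have h2 := hf.dist_le_mul x y
      rw [Real.dist_eq] at h2 ⊢
      rw [← mul_sub, abs_mul, abs_of_pos (inv_pos.2 hL), NNReal.coe_one, one_mul,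
        inv_mul_le_iff₀ hL]
      nlinarith [dist_nonneg (x := x) (y := y)]
    simp only [integral_const_mul] at h1
    exact mul_left_cancel₀ (inv_pos.2 hL).ne' h1
  let F' : ProbabilityMeasure E := ⟨F, inferInstance⟩
  let G' : ProbabilityMeasure E := ⟨G, inferInstance⟩
  have ht : Tendsto (fun _ : ℕ => F') atTop (nhds G') := by
    rw [tendsto_iff_forall_lipschitz_integral_tendsto]
    rintro f - ⟨L, hL⟩
    have hFG : ∫ x, f x ∂(F' : Measure E) = ∫ x, f x ∂(G' : Measure E) := heq f L hL
    rw [hFG]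
    exact tendsto_const_nhds
  have hFG : F' = G' := tendsto_nhds_unique tendsto_const_nhds ht
  exact congrArg (fun μ : ProbabilityMeasure E => (μ : Measure E)) hFG

end Distance

/-! ### Convergence in probability of the sample distance -/

section Convergence

variable {Ω : Type*} [MeasurableSpace Ω] {P : Measure Ω} [IsProbabilityMeasure P]
  {E : Type*} [NormedAddCommGroup E] [MeasurableSpace E] [BorelSpace E]
  [SecondCountableTopology E] {a : ℝ} {H F G : Measure E} [IsProbabilityMeasure H]
  [IsProbabilityMeasure F] [IsProbabilityMeasure G] {X Y : ℕ → Ω → E}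
  {Xpos : (n N : ℕ) → Ω → Fin N → E} {J : (n N : ℕ) → Ω → Fin N → ℝ} {n N : ℕ}

omit [NormedAddCommGroup E] [BorelSpace E] [SecondCountableTopology E] [IsProbabilityMeasure P]
  [IsProbabilityMeasure F] [IsProbabilityMeasure G] in
lemma IsPosteriorSampling.ae_mem_stdSimplex (hS : IsPosteriorSampling P a H F G X Y Xpos J)
    (ha : 0 < a) (hn : 0 < n) (hN : 0 < N) :
    ∀ᵐ ω ∂P, J n N ω ∈ stdSimplex ℝ (Fin N) := by
  have hJ := hS.law_J n N hn hN
  have hα : 0 < (a + n) / N := by positivity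
  have h := ae_dirichletMeasure_mem_stdSimplex hN hα
  rw [← hJ.map_eq] at h
  exact ae_of_ae_map hJ.aemeasurable h

omit [NormedAddCommGroup E] [BorelSpace E] [SecondCountableTopology E] [IsProbabilityMeasure P]
  [IsProbabilityMeasure F] [IsProbabilityMeasure G] in
lemma IsPosteriorSampling.integral_sum_sq_le (hS : IsPosteriorSampling P a H F G X Y Xpos J)
    (ha : 0 < a) (hn : 0 < n) (hN : 0 < N) :
    ∫ ω, ∑ i, J n N ω i ^ 2 ∂P ≤ 4 / N + 8 / (a + n) := by
  have hJ := hS.law_J n N hn hN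
  have hα : 0 < (a + n) / N := by positivity
  have hN' : (N : ℝ) ≠ 0 := by exact_mod_cast hN.ne'
  have h := integral_sum_sq_dirichletMeasure_le hN hα
  rw [← hJ.map_eq, integral_map hJ.aemeasurable (Finset.measurable_sum _ fun i _ =>
      (measurable_pi_apply i).pow_const 2).aestronglyMeasurable, mul_div_cancel₀ _ hN'] at h
  exact h

omit [NormedAddCommGroup E] [BorelSpace E] [SecondCountableTopology E] [IsProbabilityMeasure F]
  [IsProbabilityMeasure G] in
lemma IsPosteriorSampling.isWeightedSample (hS : IsPosteriorSampling P a H F G X Y Xpos J)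
    (ha : 0 < a) (hn : 0 < n) (hN : 0 < N) :
    IsWeightedSample P (J n N) (Xpos n N)
      (ENNReal.ofReal (a / (a + n)) • H + ENNReal.ofReal (n / (a + n)) • F) where
  aemeasurable_weights := (hS.law_J n N hn hN).aemeasurable
  weights_mem := hS.ae_mem_stdSimplex ha hn hN
  indep := hS.indep_J n N hn hN
  law := hasLaw_posteriorLocation ha hn hS.law_X (hS.law_Xpos n N hn hN)

omit [BorelSpace E] [SecondCountableTopology E] [NormedAddCommGroup E] [IsProbabilityMeasure H]
  [IsProbabilityMeasure F] in
lemma integrable_mixture {g : E → ℝ} (hH : Integrable g H) (hF : Integrable g F) (n : ℕ) :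
    Integrable g (ENNReal.ofReal (a / (a + n)) • H + ENNReal.ofReal (n / (a + n)) • F) :=
  (hH.smul_measure ENNReal.ofReal_ne_top).add_measure (hF.smul_measure ENNReal.ofReal_ne_top)

omit [BorelSpace E] [SecondCountableTopology E] [NormedAddCommGroup E] [IsProbabilityMeasure H]
  [IsProbabilityMeasure F] in
lemma integral_mixture_le (ha : 0 < a) {g : E → ℝ} (hg : ∀ x, 0 ≤ g x) (hH : Integrable g H)
    (hF : Integrable g F) (n : ℕ) :
    ∫ x, g x ∂(ENNReal.ofReal (a / (a + n)) • H + ENNReal.ofReal (n / (a + n)) • F) ≤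
      ∫ x, g x ∂H + ∫ x, g x ∂F := by
  have h1 : a / (a + n) ≤ 1 := div_le_one_of_le₀ (by simp) (by positivity)
  have h2 : n / (a + n) ≤ 1 := div_le_one_of_le₀ (by simp [ha.le]) (by positivity)
  rw [integral_add_measure (hH.smul_measure ENNReal.ofReal_ne_top)
    (hF.smul_measure ENNReal.ofReal_ne_top), integral_smul_measure, integral_smul_measure,
    ENNReal.toReal_ofReal (by positivity), ENNReal.toReal_ofReal (by positivity)]
  exact add_le_add (mul_le_of_le_one_left (integral_nonneg hg) h1)
    (mul_le_of_le_one_left (integral_nonneg hg) h2)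

lemma IsPosteriorSampling.exists_uniform_bound (hS : IsPosteriorSampling P a H F G X Y Xpos J)
    (ha : 0 < a) (hH : Integrable (fun x => ‖x‖) H) (hF : Integrable (fun x => ‖x‖) F)
    (hG : Integrable (fun x => ‖x‖) G) (hn : 0 < n) (hN : 0 < N) (T : SimpleFunc E E) :
    ∃ R : Ω → ℝ, Integrable R P ∧ 0 ≤ᵐ[P] R ∧
      ∫ ω, R ω ∂P ≤ 2 * (∫ y, ‖y - T y‖ ∂H + ∫ y, ‖y - T y‖ ∂F + ∫ y, ‖y - T y‖ ∂G) +
        (∑ c ∈ T.range, ‖c‖) * (√(4 / N + 8 / (a + n) + (2 * (a / (a + n)) ^ 2 + 2 * (n : ℝ)⁻¹)) +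
          √((N : ℝ)⁻¹)) ∧
      ∀ᵐ ω ∂P, ∀ f : E → ℝ, LipschitzWith 1 f →
        |∑ i, (J n N ω i * f (Xpos n N ω i) - f (Y i ω) / N) -
          (∫ y, f y ∂F - ∫ y, f y ∂G)| ≤ R ω := by
  have := isProbabilityMeasure_mixture ha n H F
  obtain ⟨R₁, hR₁, hI₁, hB₁⟩ := (hS.isWeightedSample ha hn hN).exists_uniform_bound
    (integrable_mixture hH hF n) hF (q := 2 * (a / (a + n)) ^ 2 + 2 * (n : ℝ)⁻¹) (by positivity)
    (fun z hz hz1 hz0 i k hik => integral_mul_posteriorLocation_le ha hn hS.law_X hS.indep_X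
      (hS.law_Xpos n N hn hN) hz hz1 hz0 hik) T
  obtain ⟨R₂, hR₂, hI₂, hB₂⟩ := (isWeightedSample_iid hS.law_Y hN).exists_uniform_bound
    hG hG (q := 0) le_rfl (fun z hz hz1 hz0 i k hik => (integral_mul_eq_zero_of_iid hS.law_Y
      hS.indep_Y hz hz0 fun h => hik (Fin.ext h)).le) T
  simp only [sum_sq_inv hN, integral_const, probReal_univ, one_smul, add_zero] at hI₂
  have hM := integral_mixture_le ha (fun x => norm_nonneg (x - T x))
    (integrable_norm_sub_simpleFunc hH T) (integrable_norm_sub_simpleFunc hF T) n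
  have hC : 0 ≤ ∑ c ∈ T.range, ‖c‖ := Finset.sum_nonneg fun c _ => norm_nonneg c
  -- The displacements add up to one copy for `H` and two each for `F` and `G`; a second copy for
  -- `H` gives the common factor 2.
  have hHT : 0 ≤ ∫ y, ‖y - T y‖ ∂H := integral_nonneg fun _ => norm_nonneg _
  have hsqrt := mul_le_mul_of_nonneg_left (Real.sqrt_le_sqrt (add_le_add_left
    (hS.integral_sum_sq_le ha hn hN) (2 * (a / (a + n)) ^ 2 + 2 * (n : ℝ)⁻¹))) hC
  have hbound : ∀ᵐ ω ∂P, ∀ f : E → ℝ, LipschitzWith 1 f →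
      |∑ i, (J n N ω i * f (Xpos n N ω i) - f (Y i ω) / N) -
        (∫ y, f y ∂F - ∫ y, f y ∂G)| ≤ R₁ ω + R₂ ω := by
    filter_upwards [hB₁, hB₂] with ω h₁ h₂ f hf
    have e : ∑ i, (J n N ω i * f (Xpos n N ω i) - f (Y i ω) / N) - (∫ y, f y ∂F - ∫ y, f y ∂G) =
        (∑ i, J n N ω i * f (Xpos n N ω i) - ∫ y, f y ∂F) -
          (∑ i : Fin N, (N : ℝ)⁻¹ * f (Y i ω) - ∫ y, f y ∂G) := by
      simp only [Finset.sum_sub_distrib, div_eq_inv_mul]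
      ring
    rw [e]
    exact (abs_sub _ _).trans (add_le_add (h₁ f hf) (h₂ f hf))
  refine ⟨fun ω => R₁ ω + R₂ ω, hR₁.add hR₂, ?_, ?_, hbound⟩
  · filter_upwards [hbound] with ω h
    -- Any admissible `f` shows that the bound is nonnegative; the zero function is one.
    exact (abs_nonneg _).trans (h (fun _ => 0) (LipschitzWith.const 0 |>.weaken zero_le_one))
  · rw [integral_add hR₁ hR₂, mul_add (∑ c ∈ T.range, ‖c‖)]
    linarith

lemma tendsto_samplingError (a C : ℝ) :
    Tendsto (fun p : ℕ × ℕ => C * (√(4 / p.2 + 8 / (a + p.1) +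
      (2 * (a / (a + p.1)) ^ 2 + 2 * (p.1 : ℝ)⁻¹)) + √((p.2 : ℝ)⁻¹)))
      (atTop ×ˢ atTop) (nhds 0) := by
  have h1 : Tendsto (fun p : ℕ × ℕ => (p.1 : ℝ)) (atTop ×ˢ atTop) atTop :=
    tendsto_natCast_atTop_atTop.comp tendsto_fst
  have h2 : Tendsto (fun p : ℕ × ℕ => (p.2 : ℝ)) (atTop ×ˢ atTop) atTop :=
    tendsto_natCast_atTop_atTop.comp tendsto_snd
  have h3 := tendsto_atTop_add_const_left _ a h1
  have h := ((((h2.const_div_atTop 4).add (h3.const_div_atTop 8)).add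
    ((((h3.const_div_atTop a).pow 2).const_mul 2).add (h1.inv_tendsto_atTop.const_mul 2))).sqrt.add
    h2.inv_tendsto_atTop.sqrt).const_mul C
  simpa using h

/-- The order of choices matters: `T` is fixed first, with displacement small under `H`, `F` and `G`
at once, hence uniformly in `n` and `N`. Only then do `n` and `N` grow, which kills the sampling
error on the finitely many cells. -/
theorem IsPosteriorSampling.tendstoInMeasure_discDistSample
    (hS : IsPosteriorSampling P a H F G X Y Xpos J)
    (ha : 0 < a) (hH : Integrable (fun x => ‖x‖) H) (hF : Integrable (fun x => ‖x‖) F)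
    (hG : Integrable (fun x => ‖x‖) G) {Θ : Type*} [Nonempty Θ] {D : Θ → E → ℝ}
    (hD : ∀ θ, LipschitzWith 1 (D θ)) :
    TendstoInMeasure P
      (fun (p : ℕ × ℕ) ω => discDistSample D (J p.1 p.2 ω) (Xpos p.1 p.2 ω) (fun i => Y i ω))
      (atTop ×ˢ atTop) (fun _ => discDist D F G) := by
  rw [tendstoInMeasure_iff_measureReal_dist]
  intro η hη
  rw [Metric.tendsto_nhds]
  intro δ hδ
  have hηδ : 0 < η * δ := mul_pos hη hδ
  -- The displacement enters the bound twice, so `η * δ / 4` leaves `η * δ / 2` for the sampling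
  -- error, and Markov's inequality at level `η` gives probability below `δ`.
  obtain ⟨T, hT⟩ := exists_simpleFunc_integral_norm_sub_lt
    ((hH.add_measure hF).add_measure hG) (ε := η * δ / 4) (by positivity)
  have hTi : ∀ {μ : Measure E} [IsFiniteMeasure μ], Integrable (fun x => ‖x‖) μ →
      Integrable (fun x => ‖x - T x‖) μ := fun h => integrable_norm_sub_simpleFunc h T
  rw [integral_add_measure ((hTi hH).add_measure (hTi hF)) (hTi hG),
    integral_add_measure (hTi hH) (hTi hF)] at hT
  have hev : ∀ᶠ p : ℕ × ℕ in atTop ×ˢ atTop, 0 < p.1 ∧ 0 < p.2 :=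
    (eventually_gt_atTop 0).prod_mk (eventually_gt_atTop 0)
  filter_upwards [hev, (tendsto_samplingError a (∑ c ∈ T.range, ‖c‖)).eventually_lt_const
    (show 0 < η * δ / 2 by positivity)] with p hp hlt
  obtain ⟨R, hRi, hR0, hRI, hRB⟩ := hS.exists_uniform_bound ha hH hF hG hp.1 hp.2 T
  rw [Real.dist_0_eq_abs, abs_of_nonneg measureReal_nonneg]
  have hmono : P.real {ω | η ≤ dist (discDistSample D (J p.1 p.2 ω) (Xpos p.1 p.2 ω)
      fun i => Y i ω) (discDist D F G)} ≤ P.real {ω | η ≤ R ω} := by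
    refine ENNReal.toReal_mono (measure_ne_top _ _) (measure_mono_ae ?_)
    filter_upwards [hRB] with ω hω hmem
    exact le_trans hmem (abs_ciSup_sub_ciSup_le (bddAbove_range_integral_sub hF hG hD)
      fun θ => hω (D θ) (hD θ))
  have hmarkov := mul_meas_ge_le_integral_of_nonneg hR0 hRi η
  have h1 : η * P.real {ω | η ≤ R ω} < η * δ := by linarith
  exact hmono.trans_lt (lt_of_mul_lt_mul_left h1 hη.le)

/-- The limit in probability is almost everywhere unique. Both candidate limits are constants, so
agreement at a single point suffices. -/
theorem IsPosteriorSampling.tendsToZeroInProb_iff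
    (hS : IsPosteriorSampling P a H F G X Y Xpos J)
    (ha : 0 < a) (hH : Integrable (fun x => ‖x‖) H) (hF : Integrable (fun x => ‖x‖) F)
    (hG : Integrable (fun x => ‖x‖) G) {Θ : Type*} [Nonempty Θ] {D : Θ → E → ℝ}
    (hD : ∀ θ, LipschitzWith 1 (D θ)) :
    TendsToZeroInProb P D Y Xpos J ↔ discDist D F G = 0 := by
  have h := hS.tendstoInMeasure_discDistSample ha hH hF hG hD
  refine ⟨fun h0 => ?_, fun h0 => ?_⟩
  · obtain ⟨_, hω⟩ := (tendstoInMeasure_ae_unique h h0).exists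
    exact hω
  · rw [h0] at h
    exact h

end Convergence

end BNPWasserstein

end

theorem mainTheorem2 {d : ℕ} {Ω : Type*} [MeasurableSpace Ω]
    (P : Measure Ω) [IsProbabilityMeasure P]
    (a : ℝ) (ha : 0 < a)
    (H F G : Measure (EuclideanSpace ℝ (Fin d)))
    [IsProbabilityMeasure H] [IsProbabilityMeasure F] [IsProbabilityMeasure G]
    (hH : Integrable (fun x => ‖x‖) H) (hF : Integrable (fun x => ‖x‖) F)
    (hG : Integrable (fun x => ‖x‖) G)
    (X Y : ℕ → Ω → EuclideanSpace ℝ (Fin d))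
    (Xpos : (n N : ℕ) → Ω → Fin N → EuclideanSpace ℝ (Fin d))
    (J : (n N : ℕ) → Ω → Fin N → ℝ)
    (hS : BNPWasserstein.IsPosteriorSampling P a H F G X Y Xpos J) :
    (BNPWasserstein.TendsToZeroInProb P
        (BNPWasserstein.allLipschitz (EuclideanSpace ℝ (Fin d))) Y Xpos J ↔ G = F) ∧
    ∀ {Θ : Type*} [Nonempty Θ] (Dis : Θ → EuclideanSpace ℝ (Fin d) → ℝ),
      (∀ θ, LipschitzWith 1 (Dis θ)) →
        (BNPWasserstein.TendsToZeroInProb P Dis Y Xpos J ↔ BNPWasserstein.discDist Dis F G = 0) ∧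
        (G = F → BNPWasserstein.TendsToZeroInProb P Dis Y Xpos J) ∧
        (BNPWasserstein.EqualityCondition Dis →
          (BNPWasserstein.TendsToZeroInProb P Dis Y Xpos J ↔ G = F)) := by
  have hall : Nonempty {D : EuclideanSpace ℝ (Fin d) → ℝ // LipschitzWith 1 D} :=
    ⟨⟨fun _ => 0, (LipschitzWith.const 0).weaken zero_le_one⟩⟩
  refine ⟨?_, fun {Θ} _ Dis hDis => ?_⟩
  · rw [hS.tendsToZeroInProb_iff ha hH hF hG
      (D := BNPWasserstein.allLipschitz (EuclideanSpace ℝ (Fin d))) Subtype.property]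
    exact ⟨fun h => (BNPWasserstein.eq_of_discDist_allLipschitz_eq_zero hF hG h).symm,
      fun h => h ▸ BNPWasserstein.discDist_self _ _⟩
  · have hiff := hS.tendsToZeroInProb_iff ha hH hF hG hDis
    have hself : G = F → BNPWasserstein.discDist Dis F G = 0 :=
      fun h => h ▸ BNPWasserstein.discDist_self _ _
    exact ⟨hiff, fun h => hiff.2 (hself h), fun hEq =>
      ⟨fun h => (hEq F G inferInstance inferInstance hF hG (hiff.1 h)).symm,
        fun h => hiff.2 (hself h)⟩⟩
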